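/- Let $p\ge 0$ and $q\ge 1$ be integers. Let $\mathbb{R}_{p+q}$ be the real Clifford algebra generated by $e_1,\dots,e_{p+q}$ with $e_ie_j+e_je_i=-2\delta_{ij}$, and let $\mathbb{C}_{p+q}=\mathbb{R}_{p+q}\otimes\mathbb{C}$, with basis $e_A=e_{j_1}\cdots e_{j_k}$ for $A=\{j_1<\dots<j_k\}\subseteq\{1,\dots,p+q\}$ and $e_\emptyset=e_0=1$. For $\lambda=\sum_A\lambda_Ae_A$ with $\lambda_A\in\mathbb{C}$ put $\mathrm{Sc}(\lambda)=\lambda_\emptyset$, $|\lambda|^2=\sum_A|\lambda_A|^2$ and $\lambda^\dagger=\sum_A\lambda_A^{c}\,\overline{e_A}$, where $^{c}$ is complex conjugation and $\overline{e_{j_1}\cdots e_{j_k}}=(-1)^ke_{j_k}\cdots e_{j_1}$. Write the points of $\mathbb{R}^{p+q+1}=\mathbb{R}^{p+1}\oplus\mathbb{R}^q$ as $x+\underline{y}$, where $x=\sum_{i=0}^{p}x_ie_i$ and $\underline{y}=\sum_{i=p+1}^{p+q}x_ie_i$, and let $D_x=\sum_{i=0}^pe_i\partial_{x_i}$. For $\xi\in\mathbb{R}^{p+1}$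 let $$e(x+\underline{y},\xi)=CK[e^{i\langle\cdot,\xi\rangle}](x+\underline{y}),\qquad CK[f_0](x+\underline{y})=\sum_{k=0}^{\infty}\frac{1}{k!}(\underline{y}D_x)^kf_0(x),$$ and define the Segal-Bargmann transform of $f:\mathbb{R}^{p+1}\to\mathbb{C}_{p+q}$ by $$U_{p,q}[f](\mathbf{x})=\frac{1}{(2\pi)^{p+1}}\int_{\mathbb{R}^{p+1}}\Big(\int_{\mathbb{R}^{p+1}}e(\mathbf{x},\xi)\,e^{-|\xi|^2/2}e^{-i\langle\zeta,\xi\rangle}\,d\xi\Big)f(\zeta)\,d\zeta,\qquad\mathbf{x}\in\mathbb{R}^{p+q+1}.$$ Let $$d\mu(x+\underline{y})=\frac{2}{\sqrt{\pi}}\,\frac{1}{|\mathbb{S}|}\,\frac{e^{-|\underline{y}|^2}}{|\underline{y}|^{q-1}}\,dx\,d\underline{y},\qquad|\mathbb{S}|=\frac{2\pi^{q/2}}{\Gamma(q/2)}.$$ Then for all Schwartz functions $f,h:\mathbb{R}^{p+1}\to\mathbb{C}_{p+q}$, the functions $U_{p,q}[f]$ and $U_{p,q}[h]$ belong to $L^2(\mathbb{R}^{p+q+1},d\mu)\otimes\mathbb{C}_{p+q}$,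 and $$\int_{\mathbb{R}^{p+q+1}}\mathrm{Sc}\big(U_{p,q}[f](\mathbf{x})^\dagger\,U_{p,q}[h](\mathbf{x})\big)\,d\mu(\mathbf{x})=\int_{\mathbb{R}^{p+1}}\mathrm{Sc}\big(f(x)^\dagger h(x)\big)\,dx,$$ that is, the inner product of $U_{p,q}[f]$ and $U_{p,q}[h]$ in $L^2(\mathbb{R}^{p+q+1},d\mu)\otimes\mathbb{C}_{p+q}$ equals that of $f$ and $h$ in $L^2(\mathbb{R}^{p+1},dx)\otimes\mathbb{C}_{p+q}$. -/

import Mathlib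

open MeasureTheory
open scoped TensorProduct

noncomputable section

namespace SegalBargmann

/-! ### The Clifford algebras `ℝ_n` and `ℂ_n = ℝ_n ⊗ ℂ` -/

/-- The negative definite quadratic form `v ↦ -∑ v_i ^ 2` on `ℝ ^ n`. -/
abbrev negForm (n : ℕ) : QuadraticForm ℝ (Fin n → ℝ) :=
  QuadraticMap.weightedSumSquares ℝ (fun _ : Fin n => (-1 : ℝ))

/-- The real Clifford algebra `ℝ_n`: `e_i e_j + e_j e_i = -2 δ_{ij}`. -/
abbrev RealClifford (n : ℕ) : Type := CliffordAlgebra (negForm n)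

/-- The generators `e_i` of `ℝ_n`. -/
def gen {n : ℕ} (i : Fin n) : RealClifford n :=
  CliffordAlgebra.ι (negForm n) (Pi.single i 1)

/-- The basis elements `e_A = e_{j_1} ⋯ e_{j_k}` for `A = {j_1 < ⋯ < j_k}`. -/
def blade {n : ℕ} (A : Finset (Fin n)) : RealClifford n :=
  ((A.sort (· ≤ ·)).map gen).prod

/-- The sign in `e_i e_A = ± e_{A ∆ {i}}`. -/
def sgn {n : ℕ} (i : Fin n) (A : Finset (Fin n)) : ℝ := (-1) ^ (A.filter (· ≤ i)).card

/-- The action of `e_i` on coordinates. -/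
def act {n : ℕ} (i : Fin n) : Module.End ℝ (Finset (Fin n) → ℝ) where
  toFun v B := sgn i (symmDiff B {i}) * v (symmDiff B {i})
  map_add' v w := by ext B; simp [mul_add]
  map_smul' c v := by ext B; simp; ring

theorem sgn_symmDiff {n : ℕ} (i j : Fin n) (A : Finset (Fin n)) :
    sgn i (symmDiff A {j}) = (if j ≤ i then -1 else 1) * sgn i A := by
  unfold sgn
  by_cases hj : j ≤ i
  · by_cases hA : j ∈ A
    · have h1 : (A.filter (· ≤ i)).card = ((symmDiff A {j}).filter (· ≤ i)).card + 1 := by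
        rw [← Finset.card_insert_of_notMem (a := j)
          (s := (symmDiff A {j}).filter (· ≤ i)) (by simp [Finset.mem_symmDiff, hA])]
        congr 1; ext k
        by_cases hk : k = j
        · subst hk; simp [hj, hA]
        · simp [Finset.mem_symmDiff, hk]
      rw [h1, pow_succ]; simp [hj]
    · have h1 : ((symmDiff A {j}).filter (· ≤ i)).card = (A.filter (· ≤ i)).card + 1 := by
        rw [← Finset.card_insert_of_notMem (a := j) (s := A.filter (· ≤ i)) (by simp [hA])]
        congr 1; ext k
        by_cases hk : k = j
        · subst hk; simp [hj, hA, Finset.mem_symmDiff]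
        · simp [Finset.mem_symmDiff, hk]
      rw [h1, pow_succ]; simp [hj]
  · have h1 : (symmDiff A {j}).filter (· ≤ i) = A.filter (· ≤ i) := by
      ext k
      by_cases hk : k = j
      · subst hk; simp [hj]
      · simp [Finset.mem_symmDiff, hk]
    rw [h1]; simp [hj]

theorem act_anticomm {n : ℕ} (i j : Fin n) :
    (act i * act j + act j * act i : Module.End ℝ (Finset (Fin n) → ℝ)) =
      (if i = j then (-2 : ℝ) else 0) • 1 := by
  refine LinearMap.ext fun v => ?_
  funext B
  have hsq : ∀ (A : Finset (Fin n)), sgn i A * sgn i A = 1 := by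
    intro A; unfold sgn; rw [← pow_add, ← two_mul, pow_mul]; simp
  simp only [act, LinearMap.add_apply, Module.End.mul_apply, LinearMap.coe_mk, AddHom.coe_mk,
    Pi.add_apply, LinearMap.smul_apply, Module.End.one_apply, Pi.smul_apply, smul_eq_mul]
  by_cases h : i = j
  · subst h
    rw [symmDiff_symmDiff_cancel_right, sgn_symmDiff]
    have := hsq B
    simp only [le_refl, if_true]
    linear_combination (-2 * v B) * this
  · have hc : symmDiff (symmDiff B {j}) {i} = symmDiff (symmDiff B {i}) {j} := 
      symmDiff_right_comm _ _ _
    rw [hc]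
    simp only [sgn_symmDiff, h, if_false]
    rcases lt_or_gt_of_ne h with h' | h'
    · simp only [le_refl, h'.le, not_le.mpr h', if_true, if_false]; ring
    · simp only [le_refl, h'.le, not_le.mpr h', if_true, if_false]; ring

/-- The action of `ℝ_n` on coordinates. -/
def rep (n : ℕ) : RealClifford n →ₐ[ℝ] Module.End ℝ (Finset (Fin n) → ℝ) :=
  CliffordAlgebra.lift (negForm n)
    ⟨∑ i : Fin n, (LinearMap.proj i : (Fin n → ℝ) →ₗ[ℝ] ℝ).smulRight (act i), fun v => by
      have h : (2 : ℝ) • ((∑ i, v i • act i) * (∑ j, v j • act j)) =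
          (2 : ℝ) • algebraMap ℝ (Module.End ℝ (Finset (Fin n) → ℝ)) (negForm n v) := by
        have e1 : (∑ i, v i • act i) * (∑ j, v j • act j) =
            ∑ i, ∑ j, (v i * v j) • (act i * act j) := by
          rw [Finset.sum_mul_sum]
          simp [smul_smul, mul_comm]
        have e2 : (∑ i, v i • act i) * (∑ j, v j • act j) =
            ∑ i, ∑ j, (v i * v j) • (act j * act i) := by
          rw [e1, Finset.sum_comm]
          simp [mul_comm]
        rw [two_smul]
        nth_rewrite 1 [e1]
        rw [e2, ← Finset.sum_add_distrib]
        simp_rw [← Finset.sum_add_distrib, ← smul_add, act_anticomm]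
        simp only [ite_smul, zero_smul, smul_ite, smul_zero, Finset.sum_ite_eq,
          Finset.mem_univ, if_true, QuadraticMap.weightedSumSquares_apply, smul_eq_mul,
          Algebra.algebraMap_eq_smul_one, smul_smul, ← Finset.sum_smul, Finset.mul_sum]
        congr 1
        exact Finset.sum_congr rfl fun i _ => by ring
      have h2 := smul_right_injective _ (two_ne_zero (α := ℝ)) h
      simpa [LinearMap.sum_apply] using h2⟩

theorem rep_gen {n : ℕ} (i : Fin n) : rep n (gen i) = act i := by
  unfold rep gen
  rw [CliffordAlgebra.lift_ι_apply]
  simp [LinearMap.sum_apply, Pi.single_apply]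

theorem rep_blade {n : ℕ} (A : Finset (Fin n)) :
    rep n (blade A) (Pi.single ∅ 1) = Pi.single A 1 := by
  have key : ∀ l : List (Fin n), l.SortedLT →
      rep n ((l.map gen).prod) (Pi.single ∅ 1) = Pi.single l.toFinset 1 := by
    intro l
    induction l with
    | nil => intro _; simp
    | cons i l ih =>
      intro hl
      have hp := List.pairwise_cons.mp hl.pairwise
      rw [List.map_cons, List.prod_cons, map_mul, Module.End.mul_apply, ih hp.2.sortedLT, rep_gen]
      have hi : i ∉ l.toFinset := fun h => lt_irrefl i (hp.1 i (List.mem_toFinset.mp h))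
      have hs : sgn i l.toFinset = 1 := by
        unfold sgn
        rw [Finset.filter_false_of_mem]
        · simp
        · intro k hk; exact not_le.mpr (hp.1 k (List.mem_toFinset.mp hk))
      have hins : insert i l.toFinset = symmDiff l.toFinset {i} := by
        ext k
        by_cases hk : k = i
        · subst hk; simpa [Finset.mem_symmDiff] using hi
        · simp [Finset.mem_symmDiff, hk]
      funext B
      simp only [act, LinearMap.coe_mk, AddHom.coe_mk, List.toFinset_cons, Pi.single_apply]
      by_cases hB : symmDiff B {i} = l.toFinset
      · have : B = insert i l.toFinset := by
          rw [hins, ← hB, symmDiff_symmDiff_cancel_right]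
        rw [if_pos hB, if_pos this, hB, hs, one_mul]
      · have : ¬ B = insert i l.toFinset := by
          intro h; apply hB; rw [h, hins, symmDiff_symmDiff_cancel_right]
        rw [if_neg hB, if_neg this, mul_zero]
  have := key (A.sort (· ≤ ·)) (Finset.sortedLT_sort A)
  rwa [Finset.sort_toFinset] at this

theorem linearIndependent_blade (n : ℕ) :
    LinearIndependent ℝ (blade : Finset (Fin n) → RealClifford n) := by
  let φ : RealClifford n →ₗ[ℝ] (Finset (Fin n) → ℝ) :=
    (LinearMap.applyₗ (Pi.single ∅ 1)).comp (rep n).toLinearMap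
  apply LinearIndependent.of_comp φ
  have : φ ∘ blade = fun A => Pi.single A (1 : ℝ) := by
    funext A; exact rep_blade A
  rw [this]
  exact Pi.linearIndependent_single_one _ _

theorem card_eq_finrank (n : ℕ) :
    Fintype.card (Finset (Fin n)) = Module.finrank ℝ (RealClifford n) := by
  let b := (Pi.basisFun ℝ (Fin n)).ExteriorAlgebra.map
    (CliffordAlgebra.equivExterior (negForm n)).symm
  exact (Module.finrank_eq_card_basis b).symm

/-- The basis `(e_A)` of the real Clifford algebra `ℝ_n`. -/
def bladeBasis (n : ℕ) : Module.Basis (Finset (Fin n)) ℝ (RealClifford n) :=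
  basisOfLinearIndependentOfCardEqFinrank (linearIndependent_blade n) (card_eq_finrank n)

theorem bladeBasis_apply {n : ℕ} (A : Finset (Fin n)) : bladeBasis n A = blade A := by
  simp [bladeBasis]

instance instStarModuleRealClifford (n : ℕ) : StarModule ℝ (RealClifford n) where
  star_smul r x := by simp

/-- The complex Clifford algebra `ℂ_n = ℂ ⊗ ℝ_n`. -/
def ComplexClifford (n : ℕ) : Type := ℂ ⊗[ℝ] RealClifford n

instance instRingComplexClifford (n : ℕ) : Ring (ComplexClifford n) :=
  inferInstanceAs (Ring (ℂ ⊗[ℝ] RealClifford n))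

instance instAlgebraComplexClifford (n : ℕ) : Algebra ℂ (ComplexClifford n) :=
  inferInstanceAs (Algebra ℂ (ℂ ⊗[ℝ] RealClifford n))

/-- The Hermitian conjugation `λ† = ∑ conj(λ_A) * conj(e_A)`: on `z ⊗ a` it is the complex
conjugate of `z` tensored with the Clifford conjugate of `a`. -/
instance instStarRingComplexClifford (n : ℕ) : StarRing (ComplexClifford n) :=
  inferInstanceAs (StarRing (ℂ ⊗[ℝ] RealClifford n))

/-- The inclusion of `ℝ_n` in `ℂ_n`. -/
def ofReal {n : ℕ} (a : RealClifford n) : ComplexClifford n := (1 : ℂ) ⊗ₜ[ℝ] a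

/-- The basis `(e_A)` of `ℂ_n` over `ℂ`. -/
def complexBasis (n : ℕ) : Module.Basis (Finset (Fin n)) ℂ (ComplexClifford n) :=
  Algebra.TensorProduct.basis ℂ (bladeBasis n)

theorem complexBasis_apply {n : ℕ} (A : Finset (Fin n)) :
    complexBasis n A = ofReal (blade A) := by
  simp only [complexBasis, ofReal]
  erw [Algebra.TensorProduct.basis_apply]
  rw [bladeBasis_apply]

/-- The coordinates `λ_A` of `λ = ∑ λ_A e_A`. -/
def coords (n : ℕ) : ComplexClifford n ≃ₗ[ℂ] EuclideanSpace ℂ (Finset (Fin n)) :=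
  (complexBasis n).equivFun.trans (WithLp.linearEquiv 2 ℂ (Finset (Fin n) → ℂ)).symm

/-- The norm `|λ| = (∑ |λ_A| ^ 2) ^ (1/2)`. -/
instance instNormedAddCommGroupComplexClifford (n : ℕ) :
    NormedAddCommGroup (ComplexClifford n) :=
  NormedAddCommGroup.induced _ _ (coords n) (coords n).injective

instance instNormedSpaceComplexClifford (n : ℕ) : NormedSpace ℂ (ComplexClifford n) :=
  NormedSpace.induced ℂ _ _ (coords n)

/-- The scalar part `Sc(λ) = λ_∅`. -/
def Sc {n : ℕ} (a : ComplexClifford n) : ℂ := (complexBasis n).repr a ∅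

/-- The generators `e_i` of `ℂ_n`. -/
def e {n : ℕ} (i : Fin n) : ComplexClifford n := ofReal (gen i)

/-! ### Paravectors, the Cauchy-Riemann operator and the CK-extension

The space `ℝ ^ (p+q+1)` is written `ℝ ^ (p+1) ⊕ ℝ ^ q`, its points being the pairs `(x, y)`. -/

/-- `ℝ ^ d` with its Euclidean norm. -/
abbrev Eu (d : ℕ) : Type := EuclideanSpace ℝ (Fin d)

/-- The units `e_0 = 1, e_1, …, e_p` that span the copy of `ℝ ^ (p+1)` in `ℂ_{p+q}`. -/
def unit (p q : ℕ) : Fin (p + 1) → ComplexClifford (p + q) :=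
  Fin.cons 1 (fun i : Fin p => e (Fin.castAdd q i))

/-- The `1`-vector `∑_{i=p+1}^{p+q} y_i e_i` in `ℂ_{p+q}`. -/
def vec (p q : ℕ) (y : Eu q) : ComplexClifford (p + q) :=
  ∑ j : Fin q, y j • e (Fin.natAdd p j)

/-- The operator `D_x = ∑_{i=0}^{p} e_i ∂_{x_i}`. -/
def dirac {p q : ℕ} (f : Eu (p + 1) → ComplexClifford (p + q)) :
    Eu (p + 1) → ComplexClifford (p + q) :=
  fun x => ∑ i : Fin (p + 1), unit p q i * fderiv ℝ f x (EuclideanSpace.single i 1)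

/-- The CK-extension
`CK[f](x + y) = exp(y D_x) f(x) = ∑_k (1 / k!) (y D_x) ^ k f(x)`. -/
def CK {p q : ℕ} (f : Eu (p + 1) → ComplexClifford (p + q)) (x : Eu (p + 1)) (y : Eu q) :
    ComplexClifford (p + q) :=
  ∑' k : ℕ, ((k.factorial : ℝ)⁻¹) • ((fun g u => vec p q y * dirac g u)^[k] f) x

/-- The exponential function `e(x + y, ξ) = CK[exp(i ⟨·, ξ⟩)](x + y)`. -/
def expCK (p q : ℕ) (x : Eu (p + 1)) (y : Eu q) (ξ : Eu (p + 1)) : ComplexClifford (p + q) :=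
  CK (fun u => algebraMap ℂ (ComplexClifford (p + q))
    (Complex.exp (Complex.I * (inner ℝ u ξ : ℝ)))) x y

/-! ### The Segal-Bargmann transform -/

/-- The Segal-Bargmann transform
`U[f](x + y) =
  (2π)^{-(p+1)} ∫ (∫ e(x + y, ξ) exp(-|ξ|^2 / 2) exp(-i ⟨ζ, ξ⟩) dξ) f(ζ) dζ`. -/
def segalBargmann (p q : ℕ) (f : Eu (p + 1) → ComplexClifford (p + q)) :
    Eu (p + 1) × Eu q → ComplexClifford (p + q) :=
  fun z => (1 / (2 * Real.pi) ^ (p + 1) : ℝ) •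
    ∫ ζ : Eu (p + 1), (∫ ξ : Eu (p + 1),
      ((Real.exp (-‖ξ‖ ^ 2 / 2) : ℂ) * Complex.exp (-Complex.I * (inner ℝ ζ ξ : ℝ))) •
        expCK p q z.1 z.2 ξ) * f ζ

/-- The area `|𝕊| = 2 π^{q/2} / Γ(q/2)` of the unit sphere of `ℝ ^ q`. -/
def sphereArea (q : ℕ) : ℝ := 2 * Real.pi ^ ((q : ℝ) / 2) / Real.Gamma ((q : ℝ) / 2)

/-- The measure
`dμ = (2 / √π) (1 / |𝕊|) exp(-|y|^2) / |y|^{q-1} dx dy` on `ℝ ^ (p+1) ⊕ ℝ ^ q`, for `q ≥ 1`. -/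
def mu (p q : ℕ) : Measure (Eu (p + 1) × Eu q) :=
  (volume : Measure (Eu (p + 1) × Eu q)).withDensity fun z =>
    ENNReal.ofReal (2 / √Real.pi * (1 / sphereArea q) *
      (Real.exp (-‖z.2‖ ^ 2) / ‖z.2‖ ^ (q - 1)))

/-- The inner product `⟨F, G⟩ = ∫ Sc(F† G) dν` of `L²(ν) ⊗ ℂ_n`. -/
def l2Inner {X : Type*} [MeasurableSpace X] {n : ℕ} (ν : Measure X)
    (F G : X → ComplexClifford n) : ℂ :=
  ∫ z, Sc (star (F z) * G z) ∂ν

end SegalBargmann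

end

/-! On a plane wave, `y D_x` acts as left multiplication by `M = i y ξ` (`symb`), so `e(x + y, ξ) =
exp(i⟨x, ξ⟩) exp(M)`. As `y` anticommutes with the vector part of `ξ`, `M` is Hermitian with `M² =
|y|²|ξ|²`; hence `exp(M)` is explicit in cosh and sinh (`expCK_eq`), and `exp(M)† exp(M) = exp(2M)`.

For fixed `y`, `U[f](· + y)` is the inverse Fourier transform of `exp(-|ξ|²/2) exp(M)` times the
transform of `f` (`segalBargmann_eq`). Plancherel in `x` turns the left side into an integral over
`y` and `ξ` of `exp(-|ξ|²) ⟨F, exp(2M) H⟩`, where `F`, `H` are the transforms of `f`, `h`. The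
weight is even in `y`, so the part of `exp(2M)` linear in `M` integrates to zero
(`inner_symbExp_mul_add_neg`). Polar coordinates reduce the rest to `(2/√π) ∫₀^∞ exp(-r²)
cosh(2r|ξ|) dr = exp(|ξ|²)` (`integral_weight_mul_cosh`), which cancels the Gaussian. Plancherel for
`f` and `h` concludes. -/

/-! ### Plancherel's theorem for inverse Fourier integrals. -/

section Plancherel

open FourierTransform SchwartzMap
open scoped ContDiff

variable {V F : Type*} [NormedAddCommGroup V] [InnerProductSpace ℝ V] [FiniteDimensional ℝ V]
  [MeasurableSpace V] [BorelSpace V] [NormedAddCommGroup F] [InnerProductSpace ℂ F]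
  [CompleteSpace F]

/-- On `L¹ ∩ L²` the inverse Fourier integral agrees with the inverse Fourier transform of `L²`. -/
theorem fourierInv_ae_eq_fourierInv_toLp {g : V → F} (hg : Integrable g) (hg2 : MemLp g 2) :
    𝓕⁻ g =ᵐ[volume] (𝓕⁻ (hg2.toLp g) : Lp (α := V) F 2) := by
  have hcont : Continuous (𝓕⁻ g) := by
    have : 𝓕⁻ g = fun x => 𝓕 g (-x) := funext fun x => Real.fourierInv_eq_fourier_neg g x
    rw [this]
    exact (VectorFourier.fourierIntegral_continuous Real.continuous_fourierChar
      (by exact continuous_inner) hg).comp continuous_neg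
  -- Both sides are compared as distributions, against compactly supported smooth functions.
  refine ae_eq_of_integral_contDiff_smul_eq hcont.locallyIntegrable
    ((Lp.memLp _).locallyIntegrable (by norm_num)) fun φ hφ hφc => ?_
  have hs : ContDiff ℝ ∞ (fun x => (φ x : ℂ)) := Complex.ofRealCLM.contDiff.comp hφ
  have hc : HasCompactSupport (fun x => (φ x : ℂ)) := hφc.comp_left Complex.ofReal_zero
  let ψ : 𝓢(V, ℂ) := hc.toSchwartzMap hs
  have hψ : ∀ x, ψ x = φ x := fun x => rfl
  have h1 := congrArg (fun T => T ψ) (Lp.fourierInv_toTemperedDistribution_eq (hg2.toLp g))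
  simp only [TemperedDistribution.fourierInv_apply, Lp.toTemperedDistribution_apply] at h1
  have h2 : ∫ x, (𝓕⁻ ψ) x • (hg2.toLp g) x = ∫ x, (𝓕⁻ ψ) x • g x := by
    refine integral_congr_ae ?_
    filter_upwards [hg2.coeFn_toLp] with x hx
    rw [hx]
  have h3 : ∫ x, (𝓕⁻ ψ) x • g x = ∫ x, ψ x • 𝓕⁻ g x := by
    -- The kernel is `𝐞(-L v w)`, so `L = -⟨·,·⟩` gives the inverse transform.
    have := VectorFourier.integral_bilin_fourierIntegral_eq_flip (ContinuousLinearMap.lsmul ℂ ℂ)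
      (L := -innerₗ V) (μ := volume) (ν := volume) Real.continuous_fourierChar
      (by exact (continuous_inner (𝕜 := ℝ) (E := V)).neg) ψ.integrable hg
    have hflip : (-innerₗ V).flip = -innerₗ V := by
      ext x y; simp [real_inner_comm]
    rw [hflip] at this
    rw [fourierInv_coe]
    exact this
  have h4 : ∫ x, ψ x • 𝓕⁻ g x = ∫ x, ψ x • (𝓕⁻ (hg2.toLp g) : Lp (α := V) F 2 volume) x := by
    rw [← h3, ← h2, h1]
  simpa [hψ, Complex.coe_smul] using h4

theorem memLp_fourierInv {g : V → F} (hg : Integrable g) (hg2 : MemLp g 2) :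
    MemLp (𝓕⁻ g) 2 :=
  (memLp_congr_ae (fourierInv_ae_eq_fourierInv_toLp hg hg2)).2 (Lp.memLp _)

/-- Plancherel's theorem on `L¹ ∩ L²`. -/
theorem integral_inner_fourierInv_fourierInv {g h : V → F} (hg : Integrable g) (hg2 : MemLp g 2)
    (hh : Integrable h) (hh2 : MemLp h 2) :
    ∫ x, inner ℂ (𝓕⁻ g x) (𝓕⁻ h x) = ∫ x, inner ℂ (g x) (h x) := by
  have h1 : inner ℂ (𝓕⁻ (hg2.toLp g) : Lp (α := V) F 2 volume) (𝓕⁻ (hh2.toLp h)) =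
      inner ℂ (hg2.toLp g) (hh2.toLp h) :=
    (Lp.fourierTransformₗᵢ V F).symm.inner_map_map _ _
  rw [L2.inner_def, L2.inner_def] at h1
  calc _ = _ := integral_congr_ae ?_
    _ = _ := h1
    _ = _ := integral_congr_ae ?_
  · filter_upwards [fourierInv_ae_eq_fourierInv_toLp hg hg2,
      fourierInv_ae_eq_fourierInv_toLp hh hh2] with x h1 h2
    rw [h1, h2]
  · filter_upwards [hg2.coeFn_toLp, hh2.coeFn_toLp] with x h1 h2
    rw [h1, h2]

end Plancherel

namespace SegalBargmann

open scoped ComplexConjugate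

variable {n : ℕ}

/-! ### The Hermitian inner product of the Clifford algebra -/

/-- `e_i` acts as a signed permutation matrix, and toggling `i` in the index set flips the sign, so
the matrix is skew. -/
theorem sum_act_mul (i : Fin n) (v w : Finset (Fin n) → ℝ) :
    ∑ B, act i v B * w B = -∑ B, v B * act i w B := by
  have hinv : Function.Involutive fun B : Finset (Fin n) => symmDiff B {i} :=
    fun B => symmDiff_symmDiff_cancel_right _ _
  rw [← Equiv.sum_comp (Function.Involutive.toPerm _ hinv), ← Finset.sum_neg_distrib]
  refine Finset.sum_congr rfl fun B _ => ?_
  have h := sgn_symmDiff i i B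
  simp only [le_refl, if_true] at h
  have hB : (Function.Involutive.toPerm _ hinv) B = symmDiff B {i} := rfl
  simp only [act, LinearMap.coe_mk, AddHom.coe_mk, hB, symmDiff_symmDiff_cancel_right, h]
  ring

theorem rep_ι (u : Fin n → ℝ) :
    rep n (CliffordAlgebra.ι (negForm n) u) = ∑ i, u i • act i := by
  unfold rep
  rw [CliffordAlgebra.lift_ι_apply]
  simp [LinearMap.sum_apply]

/-- Clifford conjugation is transposition in the coordinate representation: both reverse products,
and they agree on scalars and vectors. -/
theorem sum_rep_mul (a : RealClifford n) (v w : Finset (Fin n) → ℝ) :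
    ∑ B, rep n a v B * w B = ∑ B, v B * rep n (star a) w B := by
  induction a using CliffordAlgebra.induction generalizing v w with
  | algebraMap r =>
    rw [CliffordAlgebra.star_algebraMap]
    simp only [AlgHom.commutes, Module.algebraMap_end_apply, Pi.smul_apply, smul_eq_mul]
    exact Finset.sum_congr rfl fun B _ => by ring
  | ι u =>
    simp only [CliffordAlgebra.star_ι, map_neg, rep_ι, LinearMap.sum_apply, LinearMap.neg_apply,
      LinearMap.smul_apply, Finset.sum_apply, Pi.neg_apply, Pi.smul_apply, smul_eq_mul, mul_neg,
      Finset.sum_mul, Finset.mul_sum, Finset.sum_neg_distrib]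
    rw [Finset.sum_comm]
    conv_rhs => rw [Finset.sum_comm]
    rw [← Finset.sum_neg_distrib]
    refine Finset.sum_congr rfl fun i _ => ?_
    simp only [mul_assoc, mul_left_comm _ (u i), ← Finset.mul_sum]
    rw [sum_act_mul, mul_neg]
  | mul a b ha hb =>
    rw [map_mul, star_mul, map_mul]
    simp only [Module.End.mul_apply]
    rw [ha, hb]
  | add a b ha hb =>
    rw [map_add, star_add, map_add]
    simp only [LinearMap.add_apply, Pi.add_apply, add_mul, mul_add, Finset.sum_add_distrib, ha, hb]

/-- The vector `δ_∅` is cyclic: by `rep_blade`, letting `a` act on it reads off the coordinates of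
`a`. -/
theorem bladeBasis_repr (a : RealClifford n) (A : Finset (Fin n)) :
    (bladeBasis n).repr a A = rep n a (Pi.single ∅ 1) A := by
  have : (bladeBasis n).coord A = (LinearMap.proj A).comp
      ((LinearMap.applyₗ (Pi.single ∅ 1)).comp (rep n).toLinearMap) := by
    refine (bladeBasis n).ext fun B => ?_
    rw [LinearMap.comp_apply, LinearMap.comp_apply, AlgHom.toLinearMap_apply,
      LinearMap.applyₗ_apply_apply, LinearMap.proj_apply, Module.Basis.coord_apply,
      Module.Basis.repr_self, bladeBasis_apply, rep_blade, Finsupp.single_eq_pi_single]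
  exact congrArg (fun f => f a) this

theorem bladeBasis_repr_star_mul (a b : RealClifford n) :
    (bladeBasis n).repr (star a * b) ∅ =
      ∑ A, (bladeBasis n).repr a A * (bladeBasis n).repr b A := by
  have h := sum_rep_mul (star a) (rep n b (Pi.single ∅ 1)) (Pi.single ∅ 1)
  rw [star_star] at h
  simp only [bladeBasis_repr, map_mul, Module.End.mul_apply]
  simp only [Pi.single_apply, mul_ite, mul_one, mul_zero, Finset.sum_ite_eq', Finset.mem_univ,
    if_true] at h
  rw [h]
  exact Finset.sum_congr rfl fun A _ => mul_comm _ _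

theorem complexBasis_repr_tmul (z : ℂ) (a : RealClifford n) (A : Finset (Fin n)) :
    (complexBasis n).repr (z ⊗ₜ[ℝ] a : ℂ ⊗[ℝ] RealClifford n) A = z * (bladeBasis n).repr a A := by
  simp only [complexBasis]
  erw [Algebra.TensorProduct.basis_repr_tmul]
  simp

theorem ofReal_mul (a b : RealClifford n) : ofReal (a * b) = ofReal a * ofReal b :=
  (map_mul (Algebra.TensorProduct.includeRight : RealClifford n →ₐ[ℝ] ℂ ⊗[ℝ] RealClifford n) a b :)

theorem star_ofReal (a : RealClifford n) : star (ofReal a) = ofReal (star a) := by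
  have := TensorProduct.star_tmul (R := ℝ) (1 : ℂ) a
  rw [star_one] at this
  exact this

theorem star_complex_smul (z : ℂ) (x : ComplexClifford n) : star (z • x) = conj z • star x := by
  have h : ∀ x : ℂ ⊗[ℝ] RealClifford n, star (z • x) = conj z • star x := by
    intro x
    induction x using TensorProduct.induction_on with
    | zero => simp
    | add x y hx hy => rw [smul_add, star_add, hx, hy, star_add, smul_add]
    | tmul w a => simp [TensorProduct.smul_tmul', TensorProduct.star_tmul]
  exact h x

instance instStarModuleComplexClifford : StarModule ℂ (ComplexClifford n) where
  star_smul := star_complex_smul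

theorem Sc_ofReal (a : RealClifford n) : Sc (ofReal a) = (bladeBasis n).repr a ∅ := by
  rw [Sc, ofReal, complexBasis_repr_tmul, one_mul]

/-- Sesquilinearity reduces this to the orthonormality of the blades, `bladeBasis_repr_star_mul`. -/
theorem Sc_star_mul (x y : ComplexClifford n) :
    Sc (star x * y) = ∑ A, conj ((complexBasis n).repr x A) * (complexBasis n).repr y A := by
  have hadd : ∀ a b : ComplexClifford n, Sc (a + b) = Sc a + Sc b := fun a b => by simp [Sc]
  let L : ComplexClifford n →ₗ[ℂ] ℂ := (complexBasis n).coord ∅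
  have hL : ∀ a, Sc a = L a := fun a => rfl
  conv_lhs => rw [← (complexBasis n).sum_repr x, ← (complexBasis n).sum_repr y]
  rw [hL, star_sum, Finset.sum_mul_sum, map_sum]
  refine Finset.sum_congr rfl fun A _ => ?_
  rw [map_sum, Finset.sum_eq_single A]
  · rw [star_smul, smul_mul_smul_comm, map_smul, ← hL, complexBasis_apply, star_ofReal,
      ← ofReal_mul, Sc_ofReal, bladeBasis_repr_star_mul]
    simp [← bladeBasis_apply, Finsupp.single_apply]
  · intro B _ hB
    rw [star_smul, smul_mul_smul_comm, map_smul, ← hL, complexBasis_apply, complexBasis_apply,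
      star_ofReal, ← ofReal_mul, Sc_ofReal, bladeBasis_repr_star_mul]
    simp [← bladeBasis_apply, Finsupp.single_apply, hB.symm]
  · simp

-- The inner product is pulled back along `coords`, as the norm was, so no second norm arises.
noncomputable instance instInnerProductSpaceComplexClifford (n : ℕ) : InnerProductSpace ℂ (ComplexClifford n) :=
  { instNormedSpaceComplexClifford n with
    inner := fun x y => inner ℂ (coords n x) (coords n y)
    norm_sq_eq_re_inner := fun x => norm_sq_eq_re_inner (𝕜 := ℂ) (coords n x)
    conj_inner_symm := fun x y => inner_conj_symm _ _
    add_left := fun x y z => by rw [map_add, inner_add_left]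
    smul_left := fun x y r => by rw [map_smul, inner_smul_left] }

theorem inner_eq_Sc (x y : ComplexClifford n) : inner ℂ x y = Sc (star x * y) := by
  rw [Sc_star_mul]
  change inner ℂ (coords n x) (coords n y) = _
  simp [coords, PiLp.inner_apply, mul_comm]

theorem inner_mul_left (a x y : ComplexClifford n) :
    inner ℂ (a * x) y = inner ℂ x (star a * y) := by
  rw [inner_eq_Sc, inner_eq_Sc, star_mul, mul_assoc]

instance instFiniteDimensionalComplexClifford (n : ℕ) : FiniteDimensional ℂ (ComplexClifford n) :=
  Module.Basis.finiteDimensional_of_finite (complexBasis n)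

instance instCompleteSpaceComplexClifford (n : ℕ) : CompleteSpace (ComplexClifford n) :=
  FiniteDimensional.complete ℂ _

/-- Multiplication of `ℂ_n` as a continuous bilinear map. -/
noncomputable def mulCLM (n : ℕ) : ComplexClifford n →L[ℂ] ComplexClifford n →L[ℂ] ComplexClifford n :=
  LinearMap.toContinuousLinearMap
    ((LinearMap.toContinuousLinearMap :
      _ ≃ₗ[ℂ] (ComplexClifford n →L[ℂ] ComplexClifford n)).toLinearMap.comp
        (LinearMap.mul ℂ (ComplexClifford n)))

theorem mulCLM_apply (a b : ComplexClifford n) : mulCLM n a b = a * b := rfl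

instance instContinuousMulComplexClifford (n : ℕ) : ContinuousMul (ComplexClifford n) where
  continuous_mul := ((mulCLM n).continuous₂ :)

end SegalBargmann

namespace SegalBargmann

open scoped ComplexConjugate

variable {n : ℕ}

/-! ### The exponential function -/

theorem ofReal_smul (r : ℝ) (a : RealClifford n) : ofReal (r • a) = r • ofReal a := by
  have h : (1 : ℂ) ⊗ₜ[ℝ] (r • a) = (r : ℂ) • ((1 : ℂ) ⊗ₜ[ℝ] a) := by
    rw [TensorProduct.tmul_smul, TensorProduct.smul_tmul', TensorProduct.smul_tmul']
    simp
  rw [← Complex.coe_smul]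
  exact h

theorem ofReal_add (a b : RealClifford n) : ofReal (a + b) = ofReal a + ofReal b :=
  TensorProduct.tmul_add _ _ _

theorem ofReal_sum {ι : Type*} (s : Finset ι) (f : ι → RealClifford n) :
    ofReal (∑ i ∈ s, f i) = ∑ i ∈ s, ofReal (f i) :=
  TensorProduct.tmul_sum _ _ _

theorem ofReal_one : ofReal (1 : RealClifford n) = 1 := rfl

theorem ι_eq_sum (u : Fin n → ℝ) :
    CliffordAlgebra.ι (negForm n) u = ∑ i, u i • gen i := by
  conv_lhs => rw [← Finset.univ_sum_single u]
  rw [map_sum]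
  refine Finset.sum_congr rfl fun i _ => ?_
  rw [gen, ← map_smul, ← Pi.single_smul, smul_eq_mul, mul_one]

variable {p q : ℕ}

/-- Real Clifford vectors with disjoint supports let the relations between `y` and `ξ` be read off
the quadratic form. -/
theorem vec_eq_ofReal (y : Eu q) :
    vec p q y = ofReal (CliffordAlgebra.ι (negForm (p + q)) (Fin.append 0 (fun j => y j))) := by
  rw [ι_eq_sum, Fin.sum_univ_add]
  simp only [Fin.append_left, Fin.append_right, Pi.zero_apply, zero_smul, Finset.sum_const_zero,
    zero_add, ofReal_sum, ofReal_smul]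
  rfl

/-- The paravector `∑ ξ_i e_i`. -/
noncomputable def paravector (p q : ℕ) (ξ : Eu (p + 1)) : ComplexClifford (p + q) :=
  ∑ i, ξ i • unit p q i

theorem paravector_eq_ofReal (ξ : Eu (p + 1)) :
    paravector p q ξ = ofReal (ξ 0 • 1 +
      CliffordAlgebra.ι (negForm (p + q)) (Fin.append (fun i => ξ i.succ) 0)) := by
  rw [ι_eq_sum, Fin.sum_univ_add]
  simp only [Fin.append_left, Fin.append_right, Pi.zero_apply, zero_smul, Finset.sum_const_zero,
    add_zero, ofReal_sum, ofReal_smul, ofReal_add, ofReal_one]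
  rw [paravector, Fin.sum_univ_succ]
  rfl

/-- The element `i y ξ`, whose exponential is the CK-extension of the constant plane wave. -/
noncomputable def symb (p q : ℕ) (y : Eu q) (ξ : Eu (p + 1)) : ComplexClifford (p + q) :=
  Complex.I • (vec p q y * paravector p q ξ)

theorem ι_append_anticomm (u : Fin p → ℝ) (v : Fin q → ℝ) :
    CliffordAlgebra.ι (negForm (p + q)) (Fin.append u 0) *
        CliffordAlgebra.ι (negForm (p + q)) (Fin.append 0 v) =
      -(CliffordAlgebra.ι (negForm (p + q)) (Fin.append 0 v) *
        CliffordAlgebra.ι (negForm (p + q)) (Fin.append u 0)) := by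
  rw [eq_neg_iff_add_eq_zero, CliffordAlgebra.ι_mul_ι_add_swap]
  simp [QuadraticMap.polar, QuadraticMap.weightedSumSquares_apply, Fin.sum_univ_add]

theorem ι_append_left_sq (u : Fin p → ℝ) :
    CliffordAlgebra.ι (negForm (p + q)) (Fin.append u 0) *
        CliffordAlgebra.ι (negForm (p + q)) (Fin.append u 0) = (-∑ i, u i ^ 2 : ℝ) • 1 := by
  rw [CliffordAlgebra.ι_sq_scalar, Algebra.algebraMap_eq_smul_one]
  simp [QuadraticMap.weightedSumSquares_apply, Fin.sum_univ_add, sq]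

theorem ι_append_right_sq (v : Fin q → ℝ) :
    CliffordAlgebra.ι (negForm (p + q)) (Fin.append 0 v) *
        CliffordAlgebra.ι (negForm (p + q)) (Fin.append 0 v) = (-∑ i, v i ^ 2 : ℝ) • 1 := by
  rw [CliffordAlgebra.ι_sq_scalar, Algebra.algebraMap_eq_smul_one]
  simp [QuadraticMap.weightedSumSquares_apply, Fin.sum_univ_add, sq]

/-- Conjugation reverses `y ξ` to `ξ̄ (-y) = -y ξ` by anticommutation; this sign cancels the one
from conjugating `i`. -/
theorem star_symb (y : Eu q) (ξ : Eu (p + 1)) : star (symb p q y ξ) = symb p q y ξ := by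
  rw [symb, vec_eq_ofReal, paravector_eq_ofReal, ← ofReal_mul, star_smul, star_ofReal, star_mul,
    star_add, CliffordAlgebra.star_smul, star_one, CliffordAlgebra.star_ι, CliffordAlgebra.star_ι]
  have h := ι_append_anticomm (fun i => ξ i.succ) (fun j => y j)
  have : ((ξ 0 • 1 + -CliffordAlgebra.ι (negForm (p + q)) (Fin.append (fun i => ξ i.succ) 0)) *
      -CliffordAlgebra.ι (negForm (p + q)) (Fin.append 0 fun j => y j)) =
      (-1 : ℝ) • (CliffordAlgebra.ι (negForm (p + q)) (Fin.append 0 fun j => y j) *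
        (ξ 0 • 1 + CliffordAlgebra.ι (negForm (p + q)) (Fin.append (fun i => ξ i.succ) 0))) := by
    rw [add_mul, mul_add, neg_mul_neg, h]
    simp
  rw [this, ofReal_smul, ← Complex.coe_smul, smul_smul]
  simp

theorem symb_mul_self (y : Eu q) (ξ : Eu (p + 1)) :
    symb p q y ξ * symb p q y ξ = (((‖y‖ * ‖ξ‖) ^ 2 : ℝ) : ℂ) • 1 := by
  rw [symb, vec_eq_ofReal, paravector_eq_ofReal, ← ofReal_mul, smul_mul_smul_comm, ← ofReal_mul]
  have h := ι_append_anticomm (fun i => ξ i.succ) (fun j => y j)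
  have h1 := ι_append_left_sq (q := q) (fun i => ξ i.succ)
  have h2 := ι_append_right_sq (p := p) (fun j => y j)
  generalize CliffordAlgebra.ι (negForm (p + q)) (Fin.append (fun i => ξ i.succ) 0) = a at *
  generalize CliffordAlgebra.ι (negForm (p + q)) (Fin.append 0 fun j => y j) = b at *
  -- Moving `b = y` across the paravector conjugates it, leaving `y²` times the scalar `ξ̄ ξ =
  -- |ξ|²`.
  have h3 : b * (ξ 0 • 1 + a) * (b * (ξ 0 • 1 + a)) = b * b * (ξ 0 ^ 2 • 1 - a * a) := by
    have e1 : (ξ 0 • 1 + a) * b = b * (ξ 0 • 1 - a) := by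
      rw [add_mul, h, mul_sub]; simp [sub_eq_add_neg]
    have e2 : (ξ 0 • 1 - a) * (ξ 0 • 1 + a) = ξ 0 ^ 2 • 1 - a * a := by
      simp only [sub_mul, mul_add, smul_mul_assoc, one_mul, mul_smul_comm, mul_one, smul_sub,
        smul_smul, sq]
      abel
    rw [mul_assoc b, ← mul_assoc _ b, e1, ← e2]
    simp only [mul_assoc]
  have h4 : b * (ξ 0 • 1 + a) * (b * (ξ 0 • 1 + a)) = (-(‖y‖ * ‖ξ‖) ^ 2) • 1 := by
    rw [h3, h1, h2, ← sub_smul, smul_mul_smul_comm, one_mul, mul_pow, EuclideanSpace.real_norm_sq_eq,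
      EuclideanSpace.real_norm_sq_eq, Fin.sum_univ_succ]
    congr 1
    ring
  rw [h4, ofReal_smul, ofReal_one, ← Complex.coe_smul, smul_smul]
  simp

theorem symb_neg (y : Eu q) (ξ : Eu (p + 1)) : symb p q (-y) ξ = -symb p q y ξ := by
  simp [symb, vec]

theorem continuous_symb : Continuous fun z : Eu q × Eu (p + 1) => symb p q z.1 z.2 := by
  unfold symb vec paravector
  fun_prop

/-- The constant `c` on the right makes the result a function of the same form, so that the formula
can be iterated. -/
theorem dirac_plane_wave (ξ : Eu (p + 1)) (c : ComplexClifford (p + q)) :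
    dirac (fun u => Complex.exp (Complex.I * (inner ℝ u ξ : ℝ)) • c) =
      fun u => Complex.exp (Complex.I * (inner ℝ u ξ : ℝ)) • (Complex.I • (paravector p q ξ * c)) := by
  funext u
  have h : HasFDerivAt (fun u : Eu (p + 1) => Complex.exp (Complex.I * (inner ℝ u ξ : ℝ)) • c)
      ((Complex.exp (Complex.I * (inner ℝ u ξ : ℝ)) • (Complex.I •
        (Complex.ofRealCLM.comp (innerSL ℝ ξ)))).smulRight c) u := by
    have h1 : HasFDerivAt (fun u : Eu (p + 1) => ((inner ℝ u ξ : ℝ) : ℂ))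
        (Complex.ofRealCLM.comp (innerSL ℝ ξ)) u := by
      have := (Complex.ofRealCLM.comp (innerSL ℝ ξ)).hasFDerivAt (x := u)
      simpa [real_inner_comm] using! this
    exact ((h1.const_mul Complex.I).cexp).smul_const c
  simp only [dirac, h.fderiv]
  simp only [paravector, Finset.sum_mul, Finset.smul_sum]
  refine Finset.sum_congr rfl fun i _ => ?_
  simp only [ContinuousLinearMap.smulRight_apply, smul_apply,
    ContinuousLinearMap.comp_apply, innerSL_apply_apply, EuclideanSpace.inner_single_right,
    Complex.ofRealCLM_apply, smul_mul_assoc, mul_smul_comm, smul_eq_mul, conj_trivial, one_mul]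
  rw [← Complex.coe_smul (ξ i), smul_smul, smul_smul, mul_assoc]

theorem iterate_plane_wave (y : Eu q) (ξ : Eu (p + 1)) (k : ℕ) :
    (fun (g : Eu (p + 1) → ComplexClifford (p + q)) u => vec p q y * dirac g u)^[k]
        (fun u => algebraMap ℂ _ (Complex.exp (Complex.I * (inner ℝ u ξ : ℝ)))) =
      fun u => Complex.exp (Complex.I * (inner ℝ u ξ : ℝ)) • symb p q y ξ ^ k := by
  induction k with
  | zero => simp [Algebra.algebraMap_eq_smul_one]
  | succ k ih =>
    rw [Function.iterate_succ_apply', ih]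
    simp only [dirac_plane_wave]
    funext u
    rw [symb, pow_succ', mul_smul_comm, mul_smul_comm, smul_mul_assoc, mul_assoc]

/-- Even powers of `M` are scalars and odd ones scalar multiples of `M`. At `s = 0` the quotient
`sinh s / s` is `0` by convention, whereas the series still contains `M`; hence `h0`. -/
theorem hasSum_exp_of_sq {A : Type*} [Ring A] [Algebra ℝ A] [TopologicalSpace A]
    [ContinuousAdd A] [ContinuousSMul ℝ A] {M : A} {s : ℝ} (hM : M ^ 2 = s ^ 2 • 1)
    (h0 : s = 0 → M = 0) :
    HasSum (fun k : ℕ => (k.factorial : ℝ)⁻¹ • M ^ k)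
      (Real.cosh s • 1 + (Real.sinh s / s) • M) := by
  have hpow : ∀ k, M ^ (2 * k) = s ^ (2 * k) • 1 := fun k => by
    rw [pow_mul, hM, smul_pow, one_pow, pow_mul]
  refine HasSum.even_add_odd ?_ ?_
  · convert (Real.hasSum_cosh s).smul_const (1 : A) using 2 with k
    rw [hpow, smul_smul, div_eq_inv_mul]
  · rcases eq_or_ne s 0 with hs | hs
    · simp [h0 hs]
    · convert ((Real.hasSum_sinh s).div_const s).smul_const M using 2 with k
      rw [pow_succ, hpow, smul_mul_assoc, one_mul, smul_smul, pow_succ]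
      congr 1
      field_simp

/-- `exp(i y ξ) = cosh(|y||ξ|) + (sinh(|y||ξ|) / (|y||ξ|)) i y ξ`. -/
noncomputable def symbExp (p q : ℕ) (y : Eu q) (ξ : Eu (p + 1)) : ComplexClifford (p + q) :=
  Real.cosh (‖y‖ * ‖ξ‖) • 1 + (Real.sinh (‖y‖ * ‖ξ‖) / (‖y‖ * ‖ξ‖)) • symb p q y ξ

theorem expCK_eq (x : Eu (p + 1)) (y : Eu q) (ξ : Eu (p + 1)) :
    expCK p q x y ξ = Complex.exp (Complex.I * (inner ℝ x ξ : ℝ)) • symbExp p q y ξ := by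
  have h0 : ‖y‖ * ‖ξ‖ = 0 → symb p q y ξ = 0 := fun h => by
    rcases mul_eq_zero.1 h with h | h <;> rw [norm_eq_zero] at h <;>
      simp [h, symb, vec, paravector]
  have hsq : symb p q y ξ ^ 2 = (‖y‖ * ‖ξ‖) ^ 2 • 1 := by
    rw [sq, symb_mul_self, Complex.coe_smul]
  have h3 := (hasSum_exp_of_sq hsq h0).const_smul (Complex.exp (Complex.I * (inner ℝ x ξ : ℝ)))
  simp only [expCK, CK, iterate_plane_wave]
  rw [symbExp, ← h3.tsum_eq]
  refine tsum_congr fun k => ?_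
  rw [smul_comm]

end SegalBargmann

/-! ### Norms and inner products under multiplication by `exp(i y ξ)`. -/

namespace SegalBargmann

variable {p q : ℕ}

/-- A Hermitian element with scalar square is a multiple of an isometry: `‖M a‖² = ⟨a, M² a⟩`. -/
theorem norm_symb_mul (y : Eu q) (ξ : Eu (p + 1)) (a : ComplexClifford (p + q)) :
    ‖symb p q y ξ * a‖ = ‖y‖ * ‖ξ‖ * ‖a‖ := by
  have h : ‖symb p q y ξ * a‖ ^ 2 = (‖y‖ * ‖ξ‖ * ‖a‖) ^ 2 := by
    rw [norm_sq_eq_re_inner (𝕜 := ℂ), inner_mul_left, star_symb, ← mul_assoc, symb_mul_self,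
      smul_mul_assoc, one_mul, inner_smul_right, RCLike.re_to_complex, Complex.re_ofReal_mul,
      mul_pow _ ‖a‖, norm_sq_eq_re_inner (𝕜 := ℂ) a, RCLike.re_to_complex]
  exact (pow_left_inj₀ (norm_nonneg _) (by positivity) two_ne_zero).1 h

theorem symbExp_mul (y : Eu q) (ξ : Eu (p + 1)) (a : ComplexClifford (p + q)) :
    symbExp p q y ξ * a = (Real.cosh (‖y‖ * ‖ξ‖) : ℂ) • a +
      ((Real.sinh (‖y‖ * ‖ξ‖) / (‖y‖ * ‖ξ‖) : ℝ) : ℂ) • (symb p q y ξ * a) := by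
  rw [symbExp, add_mul, smul_mul_assoc, one_mul, smul_mul_assoc, Complex.coe_smul,
    Complex.coe_smul]

theorem norm_symbExp_mul_le (y : Eu q) (ξ : Eu (p + 1)) (a : ComplexClifford (p + q)) :
    ‖symbExp p q y ξ * a‖ ≤ Real.exp (‖y‖ * ‖ξ‖) * ‖a‖ := by
  have hs : 0 ≤ ‖y‖ * ‖ξ‖ := by positivity
  rw [symbExp_mul]
  refine (norm_add_le _ _).trans ?_
  rw [norm_smul, norm_smul, norm_symb_mul, Complex.norm_real, Complex.norm_real, Real.norm_eq_abs,
    Real.norm_eq_abs, abs_of_pos (Real.cosh_pos _),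
    abs_of_nonneg (div_nonneg (Real.sinh_nonneg_iff.2 hs) hs), ← Real.cosh_add_sinh, add_mul,
    ← mul_assoc]
  gcongr
  rcases eq_or_ne (‖y‖ * ‖ξ‖) 0 with h | h
  · simp [h]
  · rw [div_mul_cancel₀ _ h]

/-- This is `exp(M)† exp(M) = exp(2M)`; the factor 2 of `2M` cancels the one in `sinh(2s) / (2s)`.
-/
theorem inner_symbExp_mul (y : Eu q) (ξ : Eu (p + 1)) (a b : ComplexClifford (p + q)) :
    inner ℂ (symbExp p q y ξ * a) (symbExp p q y ξ * b) =
      (Real.cosh (2 * (‖y‖ * ‖ξ‖)) : ℂ) * inner ℂ a b +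
      ((Real.sinh (2 * (‖y‖ * ‖ξ‖)) / (‖y‖ * ‖ξ‖) : ℝ) : ℂ) * inner ℂ a (symb p q y ξ * b) := by
  have h1 : inner ℂ (symb p q y ξ * a) b = inner ℂ a (symb p q y ξ * b) := by
    rw [inner_mul_left, star_symb]
  have h2 : inner ℂ (symb p q y ξ * a) (symb p q y ξ * b) =
      (((‖y‖ * ‖ξ‖) ^ 2 : ℝ) : ℂ) * inner ℂ a b := by
    rw [inner_mul_left, star_symb, ← mul_assoc, symb_mul_self, smul_mul_assoc, one_mul,
      inner_smul_right]
  have h3 : (Real.sinh (‖y‖ * ‖ξ‖) / (‖y‖ * ‖ξ‖)) ^ 2 * (‖y‖ * ‖ξ‖) ^ 2 =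
      Real.sinh (‖y‖ * ‖ξ‖) ^ 2 := by
    rcases eq_or_ne (‖y‖ * ‖ξ‖) 0 with h | h
    · simp [h]
    · rw [div_pow, div_mul_cancel₀ _ (pow_ne_zero 2 h)]
  rw [symbExp_mul, symbExp_mul]
  simp only [inner_add_left, inner_add_right, inner_smul_left, inner_smul_right, h1, h2,
    Complex.conj_ofReal, Real.cosh_two_mul, Real.sinh_two_mul]
  rw [← h3]
  push_cast
  ring

theorem inner_symbExp_mul_add_neg (y : Eu q) (ξ : Eu (p + 1)) (a b : ComplexClifford (p + q)) :
    inner ℂ (symbExp p q y ξ * a) (symbExp p q y ξ * b) +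
        inner ℂ (symbExp p q (-y) ξ * a) (symbExp p q (-y) ξ * b) =
      2 * ((Real.cosh (2 * (‖y‖ * ‖ξ‖)) : ℂ) * inner ℂ a b) := by
  rw [inner_symbExp_mul, inner_symbExp_mul, norm_neg, symb_neg, neg_mul, inner_neg_right]
  ring

theorem stronglyMeasurable_symbExp :
    StronglyMeasurable fun z : Eu q × Eu (p + 1) => symbExp p q z.1 z.2 := by
  have hs : Continuous fun z : Eu q × Eu (p + 1) => ‖z.1‖ * ‖z.2‖ := by fun_prop
  exact ((Real.continuous_cosh.comp hs).stronglyMeasurable.smul stronglyMeasurable_const).add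
    (((Real.continuous_sinh.comp hs).measurable.div hs.measurable).stronglyMeasurable.smul
      continuous_symb.stronglyMeasurable)

/-! ### The weight -/

/-- The density of `mu` as a function of `y`. -/
noncomputable def weight (q : ℕ) (y : Eu q) : ℝ :=
  2 / √Real.pi * (1 / sphereArea q) * (Real.exp (-‖y‖ ^ 2) / ‖y‖ ^ (q - 1))

theorem sphereArea_pos (hq : 1 ≤ q) : 0 < sphereArea q := by
  have : (0 : ℝ) < q := by exact_mod_cast hq
  have := Real.Gamma_pos_of_pos (half_pos this)
  unfold sphereArea
  positivity

theorem weight_nonneg (hq : 1 ≤ q) (y : Eu q) : 0 ≤ weight q y := by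
  have := sphereArea_pos hq
  unfold weight
  positivity

theorem measurable_weight : Measurable (weight q) := by
  unfold weight
  fun_prop

theorem weight_neg (y : Eu q) : weight q (-y) = weight q y := by
  simp [weight]

theorem volume_real_ball_mul (hq : 1 ≤ q) :
    q * (volume : Measure (Eu q)).real (Metric.ball 0 1) = sphereArea q := by
  have : Nonempty (Fin q) := ⟨⟨0, hq⟩⟩
  have hq' : (0 : ℝ) < q := by exact_mod_cast hq
  have hG := Real.Gamma_pos_of_pos (half_pos hq')
  rw [Measure.real, EuclideanSpace.volume_ball]
  simp only [ENNReal.ofReal_one, one_pow, one_mul, Fintype.card_fin]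
  rw [Real.Gamma_add_one (half_pos hq').ne', ENNReal.toReal_ofReal (by positivity), sphereArea,
    Real.sqrt_eq_rpow, ← Real.rpow_natCast, ← Real.rpow_mul Real.pi_pos.le]
  field_simp

/-- The factor `|y|^(q-1)` in the denominator cancels the polar Jacobian, and `1 / |𝕊|` the area of
the sphere, so the result does not depend on `q`. -/
theorem integral_weight_mul (hq : 1 ≤ q) (φ : ℝ → ℝ) :
    ∫ y : Eu q, weight q y * φ ‖y‖ =
      2 / √Real.pi * ∫ r in Set.Ioi (0 : ℝ), Real.exp (-r ^ 2) * φ r := by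
  have : Nonempty (Fin q) := ⟨⟨0, hq⟩⟩
  have hS := sphereArea_pos hq
  have h := integral_fun_norm_addHaar (volume : Measure (Eu q)) fun r =>
    2 / √Real.pi * (1 / sphereArea q) * (Real.exp (-r ^ 2) / r ^ (q - 1)) * φ r
  simp only [finrank_euclideanSpace, Fintype.card_fin, nsmul_eq_mul, smul_eq_mul] at h
  rw [← mul_assoc, volume_real_ball_mul hq] at h
  refine h.trans ?_
  rw [← integral_const_mul, ← integral_const_mul]
  refine setIntegral_congr_fun measurableSet_Ioi fun r hr => ?_
  have hr : r ≠ 0 := (Set.mem_Ioi.1 hr).ne'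
  field_simp

theorem integrable_weight_mul (hq : 1 ≤ q) {φ : ℝ → ℝ}
    (hφ : IntegrableOn (fun r => Real.exp (-r ^ 2) * φ r) (Set.Ioi 0)) :
    Integrable fun y : Eu q => weight q y * φ ‖y‖ := by
  have : Nonempty (Fin q) := ⟨⟨0, hq⟩⟩
  have hS := sphereArea_pos hq
  have h := integrable_fun_norm_addHaar (volume : Measure (Eu q)) (f := fun r =>
    2 / √Real.pi * (1 / sphereArea q) * (Real.exp (-r ^ 2) / r ^ (q - 1)) * φ r)
  refine h.2 ?_
  refine IntegrableOn.congr_fun (hφ.const_mul (2 / √Real.pi * (1 / sphereArea q)))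
    (fun r hr => ?_) measurableSet_Ioi
  have hr : r ≠ 0 := (Set.mem_Ioi.1 hr).ne'
  simp only [finrank_euclideanSpace, Fintype.card_fin, smul_eq_mul]
  field_simp

theorem exp_neg_sq_mul_exp (t r : ℝ) :
    Real.exp (-r ^ 2) * Real.exp (2 * (r * t)) =
      Real.exp (t ^ 2) * Real.exp (-1 * (r - t) ^ 2) := by
  rw [← Real.exp_add, ← Real.exp_add]
  ring_nf

theorem integrable_exp_neg_sq_mul_exp (t : ℝ) :
    Integrable fun r : ℝ => Real.exp (-r ^ 2) * Real.exp (2 * (r * t)) := by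
  simp only [exp_neg_sq_mul_exp]
  exact ((integrable_exp_neg_mul_sq one_pos).comp_sub_right t).const_mul _

theorem integral_exp_neg_sq_mul_exp (t : ℝ) :
    ∫ r : ℝ, Real.exp (-r ^ 2) * Real.exp (2 * (r * t)) = √Real.pi * Real.exp (t ^ 2) := by
  simp only [exp_neg_sq_mul_exp, integral_const_mul]
  rw [integral_sub_right_eq_self (fun r : ℝ => Real.exp (-1 * r ^ 2)), integral_gaussian, div_one,
    mul_comm]

theorem integrable_exp_neg_sq_mul_cosh (t : ℝ) :
    Integrable fun r : ℝ => Real.exp (-r ^ 2) * Real.cosh (2 * (r * t)) := by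
  have h := ((integrable_exp_neg_sq_mul_exp t).add (integrable_exp_neg_sq_mul_exp (-t))).div_const 2
  refine h.congr (ae_of_all _ fun r => ?_)
  simp only [Pi.add_apply, Real.cosh_eq, mul_neg]
  ring

theorem integral_exp_neg_sq_mul_cosh (t : ℝ) :
    ∫ r in Set.Ioi (0 : ℝ), Real.exp (-r ^ 2) * Real.cosh (2 * (r * t)) =
      √Real.pi / 2 * Real.exp (t ^ 2) := by
  -- The integrand is even, so the half-line integral is half of the full Gaussian integral.
  have h1 := integral_comp_abs (f := fun r : ℝ => Real.exp (-r ^ 2) * Real.cosh (2 * (r * t)))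
  have h2 : ∀ r : ℝ, Real.exp (-|r| ^ 2) * Real.cosh (2 * (|r| * t)) =
      (Real.exp (-r ^ 2) * Real.exp (2 * (r * t)) +
        Real.exp (-r ^ 2) * Real.exp (2 * (r * -t))) / 2 := by
    intro r
    have : Real.cosh (2 * (|r| * t)) = Real.cosh (2 * (r * t)) := by
      rcases abs_choice r with h | h <;> rw [h]
      rw [neg_mul, mul_neg, Real.cosh_neg]
    rw [this, sq_abs, Real.cosh_eq, mul_neg, mul_neg]
    ring
  simp only [h2] at h1
  rw [integral_div, integral_add (integrable_exp_neg_sq_mul_exp t)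
    (integrable_exp_neg_sq_mul_exp (-t)), integral_exp_neg_sq_mul_exp, integral_exp_neg_sq_mul_exp,
    neg_sq] at h1
  linarith

theorem integrable_weight_mul_cosh (hq : 1 ≤ q) (t : ℝ) :
    Integrable fun y : Eu q => weight q y * Real.cosh (2 * (‖y‖ * t)) :=
  integrable_weight_mul hq (φ := fun r => Real.cosh (2 * (r * t)))
    (integrable_exp_neg_sq_mul_cosh t).integrableOn

theorem integral_weight_mul_cosh (hq : 1 ≤ q) (t : ℝ) :
    ∫ y : Eu q, weight q y * Real.cosh (2 * (‖y‖ * t)) = Real.exp (t ^ 2) := by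
  rw [integral_weight_mul hq (fun r => Real.cosh (2 * (r * t))), integral_exp_neg_sq_mul_cosh]
  field_simp

end SegalBargmann

namespace SegalBargmann

open FourierTransform SchwartzMap

variable {p q : ℕ}

/-! ### The transform as a family of inverse Fourier transforms -/

/-- The function of `w` whose inverse Fourier transform at `x` is `U[f](x + y)`, where `F` is the
Fourier transform of `f`. -/
noncomputable def profile (p q : ℕ) (F : Eu (p + 1) → ComplexClifford (p + q)) (y : Eu q)
    (w : Eu (p + 1)) : ComplexClifford (p + q) :=
  (Real.exp (-‖(2 * Real.pi) • w‖ ^ 2 / 2) : ℂ) • (symbExp p q y ((2 * Real.pi) • w) * F w)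

theorem integrable_exp_neg_sq_add {V : Type*} [NormedAddCommGroup V] [InnerProductSpace ℝ V]
    [FiniteDimensional ℝ V] [MeasurableSpace V] [BorelSpace V] (c : ℝ) :
    Integrable fun ξ : V => Real.exp (-‖ξ‖ ^ 2 / 2 + c * ‖ξ‖) := by
  have h : Integrable fun ξ : V => Real.exp (-(1 / 4) * ‖ξ‖ ^ 2) := by
    have := (GaussianFourier.integrable_cexp_neg_mul_sq_norm_add (V := V) (b := 1 / 4)
      (by norm_num) 0 0).norm
    refine this.congr (ae_of_all _ fun ξ => ?_)
    simp [Complex.norm_exp, ← Complex.ofReal_pow]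
  refine (h.const_mul (Real.exp (c ^ 2))).mono' (by fun_prop) (ae_of_all _ fun ξ => ?_)
  rw [Real.norm_eq_abs, abs_of_pos (Real.exp_pos _), ← Real.exp_add]
  refine Real.exp_le_exp.2 ?_
  -- This is `-t²/2 + ct ≤ c² - t²/4` with `t = ‖ξ‖`.
  nlinarith [sq_nonneg (‖ξ‖ / 2 - c)]

theorem integrable_kernel (x : Eu (p + 1)) (y : Eu q) :
    Integrable fun ξ : Eu (p + 1) => (Real.exp (-‖ξ‖ ^ 2 / 2) : ℂ) • expCK p q x y ξ := by
  refine ((integrable_exp_neg_sq_add (V := Eu (p + 1)) ‖y‖).mul_const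
    ‖(1 : ComplexClifford (p + q))‖).mono' ?_ (ae_of_all _ fun ξ => ?_)
  · simp only [expCK_eq]
    have h1 : Continuous fun ξ : Eu (p + 1) => (Real.exp (-‖ξ‖ ^ 2 / 2) : ℂ) := by fun_prop
    have h2 : Continuous fun ξ : Eu (p + 1) =>
        Complex.exp (Complex.I * (inner ℝ x ξ : ℝ)) := by fun_prop
    refine h1.aestronglyMeasurable.smul (h2.aestronglyMeasurable.smul ?_)
    exact (stronglyMeasurable_symbExp.comp_measurable
      (measurable_prodMk_left (x := y))).aestronglyMeasurable
  · have h := norm_symbExp_mul_le y ξ (1 : ComplexClifford (p + q))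
    rw [mul_one] at h
    rw [expCK_eq, norm_smul, norm_smul, mul_comm Complex.I, Complex.norm_exp_ofReal_mul_I, one_mul,
      Complex.norm_real, Real.norm_eq_abs, abs_of_pos (Real.exp_pos _), Real.exp_add, mul_assoc]
    gcongr

/-- The multiplication formula moves the Fourier integral from the kernel to `f`. The substitution
`ξ = 2πw` then matches the normalisation of `𝓕⁻` and absorbs `(2π)^{-(p+1)}`. -/
theorem segalBargmann_eq (f : 𝓢(Eu (p + 1), ComplexClifford (p + q))) (x : Eu (p + 1))
    (y : Eu q) :
    segalBargmann p q f (x, y) = 𝓕⁻ (profile p q (𝓕 f : 𝓢(_, _)) y) x := by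
  have hpi : (2 * Real.pi) ≠ 0 := by positivity
  -- Chosen so that `𝐞(-L ξ ζ) = exp(-i⟨ζ, ξ⟩)`.
  let L : Eu (p + 1) →ₗ[ℝ] Eu (p + 1) →ₗ[ℝ] ℝ := (2 * Real.pi)⁻¹ • innerₗ (Eu (p + 1))
  have hLflip : L.flip = L := by
    ext x y; simp [L, real_inner_comm]
  set k := fun ξ : Eu (p + 1) => (Real.exp (-‖ξ‖ ^ 2 / 2) : ℂ) • expCK p q x y ξ with hk
  have hflip := VectorFourier.integral_bilin_fourierIntegral_eq_flip (mulCLM (p + q))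
    (L := L) (μ := volume) (ν := volume) Real.continuous_fourierChar
    (by exact (continuous_inner (𝕜 := ℝ) (E := Eu (p + 1))).const_smul (2 * Real.pi)⁻¹)
    (integrable_kernel x y) f.integrable
  rw [hLflip] at hflip
  simp only [mulCLM_apply] at hflip
  have h1 : ∀ ζ, VectorFourier.fourierIntegral Real.fourierChar volume L k ζ = ∫ ξ : Eu (p + 1),
      ((Real.exp (-‖ξ‖ ^ 2 / 2) : ℂ) * Complex.exp (-Complex.I * (inner ℝ ζ ξ : ℝ))) •
        expCK p q x y ξ := by
    intro ζ
    refine integral_congr_ae (ae_of_all _ fun ξ => ?_)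
    simp only [hk, Circle.smul_def, Real.fourierChar_apply, smul_smul, L, LinearMap.smul_apply,
      innerₗ_apply_apply, smul_eq_mul]
    rw [mul_comm, real_inner_comm ζ ξ]
    congr 3
    push_cast
    field_simp
  have h2 : ∀ ξ, VectorFourier.fourierIntegral Real.fourierChar volume L f ξ =
      𝓕 f ((2 * Real.pi)⁻¹ • ξ) := by
    intro ξ
    rw [fourier_coe, Real.fourier_eq]
    refine integral_congr_ae (ae_of_all _ fun ζ => ?_)
    simp [L, inner_smul_right]
  have h3 := Measure.integral_comp_smul (volume : Measure (Eu (p + 1)))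
    (fun ξ => k ξ * 𝓕 f ((2 * Real.pi)⁻¹ • ξ)) (2 * Real.pi)
  simp only [finrank_euclideanSpace, Fintype.card_fin] at h3
  have hpos : |((2 * Real.pi) ^ (p + 1))⁻¹| = 1 / (2 * Real.pi) ^ (p + 1) := by
    rw [abs_of_pos (by positivity), one_div]
  rw [hpos] at h3
  simp only [segalBargmann, ← h1]
  rw [hflip]
  simp only [h2]
  rw [← h3, Real.fourierInv_eq']
  refine integral_congr_ae (ae_of_all _ fun w => ?_)
  simp only [hk, profile, smul_smul, inv_mul_cancel₀ hpi, one_smul, expCK_eq, smul_mul_assoc]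
  rw [mul_comm]
  congr 3
  rw [inner_smul_right, real_inner_comm]
  push_cast
  ring

/-- Since `-t²/2 + |y|t ≤ |y|²/2`, the Gaussian controls `exp(M)` uniformly in `w`, and the profile
inherits the integrability of `F`. -/
theorem norm_profile_le (F : Eu (p + 1) → ComplexClifford (p + q)) (y : Eu q) (w : Eu (p + 1)) :
    ‖profile p q F y w‖ ≤ Real.exp (‖y‖ ^ 2 / 2) * ‖F w‖ := by
  rw [profile, norm_smul, Complex.norm_real, Real.norm_eq_abs, abs_of_pos (Real.exp_pos _)]
  refine (mul_le_mul_of_nonneg_left (norm_symbExp_mul_le _ _ _) (Real.exp_pos _).le).trans ?_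
  rw [← mul_assoc, ← Real.exp_add]
  gcongr
  nlinarith [sq_nonneg (‖y‖ - ‖(2 * Real.pi) • w‖)]

theorem stronglyMeasurable_profile {F : Eu (p + 1) → ComplexClifford (p + q)}
    (hF : Continuous F) :
    StronglyMeasurable fun z : Eu q × Eu (p + 1) => profile p q F z.1 z.2 := by
  have h1 : StronglyMeasurable fun z : Eu q × Eu (p + 1) =>
      symbExp p q z.1 ((2 * Real.pi) • z.2) :=
    stronglyMeasurable_symbExp.comp_measurable
      (g := fun z : Eu q × Eu (p + 1) => (z.1, (2 * Real.pi) • z.2)) (by fun_prop)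
  have h2 : Continuous fun z : Eu q × Eu (p + 1) =>
      (Real.exp (-‖(2 * Real.pi) • z.2‖ ^ 2 / 2) : ℂ) := by fun_prop
  refine h2.stronglyMeasurable.smul ?_
  exact h1.mul (hF.comp continuous_snd).stronglyMeasurable

theorem memLp_profile (F : 𝓢(Eu (p + 1), ComplexClifford (p + q))) (r : ENNReal) (y : Eu q) :
    MemLp (profile p q F y) r := by
  refine ((F.memLp r volume).norm.const_mul (Real.exp (‖y‖ ^ 2 / 2))).mono
    ((stronglyMeasurable_profile F.continuous).comp_measurable
      (measurable_prodMk_left (x := y))).aestronglyMeasurable (ae_of_all _ fun w => ?_)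
  refine (norm_profile_le _ _ _).trans (le_abs_self _)

theorem integrable_profile (F : 𝓢(Eu (p + 1), ComplexClifford (p + q))) (y : Eu q) :
    Integrable (profile p q F y) :=
  memLp_one_iff_integrable.1 (memLp_profile F 1 y)

theorem aestronglyMeasurable_segalBargmann (f : 𝓢(Eu (p + 1), ComplexClifford (p + q)))
    (μ : Measure (Eu (p + 1) × Eu q)) : AEStronglyMeasurable (segalBargmann p q f) μ := by
  have h : segalBargmann p q f = fun z : Eu (p + 1) × Eu q => ∫ w : Eu (p + 1),
      Complex.exp ((2 * Real.pi * inner ℝ w z.1 : ℝ) * Complex.I) • profile p q (𝓕 f : 𝓢(_, _)) z.2 w := by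
    funext z
    rw [← Real.fourierInv_eq', ← segalBargmann_eq]
  rw [h]
  refine (StronglyMeasurable.integral_prod_right (f := fun (z : Eu (p + 1) × Eu q) w =>
    Complex.exp ((2 * Real.pi * inner ℝ w z.1 : ℝ) * Complex.I) •
      profile p q (𝓕 f : 𝓢(_, _)) z.2 w) ?_).aestronglyMeasurable
  have h2 : Continuous fun z : (Eu (p + 1) × Eu q) × Eu (p + 1) =>
      Complex.exp ((2 * Real.pi * inner ℝ z.2 z.1.1 : ℝ) * Complex.I) := by fun_prop
  refine h2.stronglyMeasurable.smul ?_
  exact (stronglyMeasurable_profile (𝓕 f).continuous).comp_measurable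
    (g := fun z : (Eu (p + 1) × Eu q) × Eu (p + 1) => (z.1.2, z.2)) (by fun_prop)

/-! ### Integration against the weight -/

theorem inner_profile (F H : Eu (p + 1) → ComplexClifford (p + q)) (y : Eu q) (w : Eu (p + 1)) :
    inner ℂ (profile p q F y w) (profile p q H y w) =
      (Real.exp (-‖(2 * Real.pi) • w‖ ^ 2) : ℂ) *
        inner ℂ (symbExp p q y ((2 * Real.pi) • w) * F w)
          (symbExp p q y ((2 * Real.pi) • w) * H w) := by
  rw [profile, profile, inner_smul_left, inner_smul_right, ← mul_assoc, Complex.conj_ofReal,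
    ← Complex.ofReal_mul, ← Real.exp_add]
  congr 4
  ring

/-- The bound `exp(2s) ≤ 2 cosh(2s)` gives a majorant whose weighted integral over `y` is known
exactly. -/
theorem norm_inner_profile_le (F H : Eu (p + 1) → ComplexClifford (p + q)) (y : Eu q)
    (w : Eu (p + 1)) :
    ‖inner ℂ (profile p q F y w) (profile p q H y w)‖ ≤
      Real.cosh (2 * (‖y‖ * ‖(2 * Real.pi) • w‖)) *
        (Real.exp (-‖(2 * Real.pi) • w‖ ^ 2) * (2 * (‖F w‖ * ‖H w‖))) := by
  rw [inner_profile, norm_mul, Complex.norm_real, Real.norm_eq_abs, abs_of_pos (Real.exp_pos _)]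
  have h1 := norm_inner_le_norm (𝕜 := ℂ) (symbExp p q y ((2 * Real.pi) • w) * F w)
    (symbExp p q y ((2 * Real.pi) • w) * H w)
  have h2 := mul_le_mul (norm_symbExp_mul_le y ((2 * Real.pi) • w) (F w))
    (norm_symbExp_mul_le y ((2 * Real.pi) • w) (H w)) (norm_nonneg _) (by positivity)
  have h3 : Real.exp (‖y‖ * ‖(2 * Real.pi) • w‖) * Real.exp (‖y‖ * ‖(2 * Real.pi) • w‖) ≤
      2 * Real.cosh (2 * (‖y‖ * ‖(2 * Real.pi) • w‖)) := by
    rw [← Real.exp_add, Real.cosh_eq, ← two_mul]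
    linarith [Real.exp_pos (-(2 * (‖y‖ * ‖(2 * Real.pi) • w‖)))]
  have h4 := mul_le_mul_of_nonneg_right h3 (by positivity : 0 ≤ ‖F w‖ * ‖H w‖)
  calc _ ≤ Real.exp (-‖(2 * Real.pi) • w‖ ^ 2) *
        (2 * Real.cosh (2 * (‖y‖ * ‖(2 * Real.pi) • w‖)) * (‖F w‖ * ‖H w‖)) := by
        gcongr; linarith
    _ = _ := by ring

/-- By Tonelli with `y` integrated first: the weighted cosh gives `exp(τ²)`, which cancels
`exp(-τ²)` and leaves `φ`. -/
theorem integrable_weight_mul_cosh_mul {V : Type*} [MeasurableSpace V] {ν : Measure V} [SFinite ν]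
    (hq : 1 ≤ q) {τ φ : V → ℝ} (hτ : Measurable τ) (hφ : Integrable φ ν) (hφ0 : ∀ w, 0 ≤ φ w) :
    Integrable (fun z : Eu q × V => weight q z.1 * Real.cosh (2 * (‖z.1‖ * τ z.2)) *
      (Real.exp (-τ z.2 ^ 2) * φ z.2)) (volume.prod ν) := by
  have h1 : Measurable fun z : Eu q × V =>
      weight q z.1 * Real.cosh (2 * (‖z.1‖ * τ z.2)) * Real.exp (-τ z.2 ^ 2) := by
    have := measurable_weight (q := q)
    fun_prop
  have hmeas : AEStronglyMeasurable (fun z : Eu q × V =>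
      weight q z.1 * Real.cosh (2 * (‖z.1‖ * τ z.2)) * (Real.exp (-τ z.2 ^ 2) * φ z.2))
      (volume.prod ν) :=
    (h1.aestronglyMeasurable.mul hφ.aestronglyMeasurable.comp_snd).congr
      (ae_of_all _ fun z => mul_assoc _ _ _)
  have hnn : ∀ (w : V) (y : Eu q), ‖weight q y * Real.cosh (2 * (‖y‖ * τ w)) *
      (Real.exp (-τ w ^ 2) * φ w)‖ =
      weight q y * Real.cosh (2 * (‖y‖ * τ w)) * (Real.exp (-τ w ^ 2) * φ w) := fun w y =>
    Real.norm_of_nonneg (mul_nonneg (mul_nonneg (weight_nonneg hq y) (Real.cosh_pos _).le)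
      (mul_nonneg (Real.exp_pos _).le (hφ0 w)))
  rw [integrable_prod_iff' hmeas]
  refine ⟨ae_of_all _ fun w => (integrable_weight_mul_cosh hq (τ w)).mul_const
    (Real.exp (-τ w ^ 2) * φ w), ?_⟩
  refine hφ.congr (ae_of_all _ fun w => ?_)
  simp only [hnn]
  rw [integral_mul_const, integral_weight_mul_cosh hq, ← mul_assoc, ← Real.exp_add,
    add_neg_cancel, Real.exp_zero, one_mul]

theorem integrable_weight_inner_profile (hq : 1 ≤ q)
    (F H : 𝓢(Eu (p + 1), ComplexClifford (p + q))) :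
    Integrable (fun z : Eu q × Eu (p + 1) => (weight q z.1 : ℂ) *
      inner ℂ (profile p q F z.1 z.2) (profile p q H z.1 z.2)) (volume.prod volume) := by
  have hFH : Integrable fun w => 2 * (‖F w‖ * ‖H w‖) :=
    ((F.memLp 2 volume).norm.integrable_mul (H.memLp 2 volume).norm).const_mul 2
  have hτ : Measurable fun w : Eu (p + 1) => ‖(2 * Real.pi) • w‖ := by fun_prop
  have hB := integrable_weight_mul_cosh_mul (q := q) hq hτ hFH fun w => by positivity
  refine hB.mono' ?_ (ae_of_all _ fun z => ?_)
  · exact (AEStronglyMeasurable.mul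
      (Complex.measurable_ofReal.comp (measurable_weight.comp measurable_fst)).aestronglyMeasurable
      ((stronglyMeasurable_profile F.continuous).aestronglyMeasurable.inner
        (stronglyMeasurable_profile H.continuous).aestronglyMeasurable))
  · rw [norm_mul, Complex.norm_real, Real.norm_eq_abs, abs_of_nonneg (weight_nonneg hq _),
      mul_assoc]
    exact mul_le_mul_of_nonneg_left (norm_inner_profile_le _ _ _ _) (weight_nonneg hq _)

theorem integral_weight_inner_profile (hq : 1 ≤ q) (F H : Eu (p + 1) → ComplexClifford (p + q))
    (w : Eu (p + 1))
    (hint : Integrable fun y : Eu q => (weight q y : ℂ) *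
      inner ℂ (profile p q F y w) (profile p q H y w)) :
    ∫ y : Eu q, (weight q y : ℂ) * inner ℂ (profile p q F y w) (profile p q H y w) =
      inner ℂ (F w) (H w) := by
  set t := ‖(2 * Real.pi) • w‖
  -- Adding the integral to its reflection under `y ↦ -y` removes the term odd in `y`.
  have h1 := integral_neg_eq_self (fun y : Eu q => (weight q y : ℂ) *
    inner ℂ (profile p q F y w) (profile p q H y w)) volume
  have h2 : ∀ y : Eu q, (weight q y : ℂ) * inner ℂ (profile p q F y w) (profile p q H y w) +
      (weight q (-y) : ℂ) * inner ℂ (profile p q F (-y) w) (profile p q H (-y) w) =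
      ((weight q y * Real.cosh (2 * (‖y‖ * t)) : ℝ) : ℂ) *
        (2 * (Real.exp (-t ^ 2) : ℂ) * inner ℂ (F w) (H w)) := fun y => by
    rw [inner_profile, inner_profile, weight_neg, ← mul_add, ← mul_add, inner_symbExp_mul_add_neg]
    push_cast
    ring
  have h3 := integral_add hint hint.comp_neg
  rw [h1] at h3
  simp only [h2] at h3
  rw [integral_mul_const, integral_complex_ofReal, integral_weight_mul_cosh hq] at h3
  have h4 : (Real.exp (t ^ 2) : ℂ) * (Real.exp (-t ^ 2) : ℂ) = 1 := by
    rw [← Complex.ofReal_mul, ← Real.exp_add]; simp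
  linear_combination (-1 / 2 : ℂ) * h3 + inner ℂ (F w) (H w) * h4

/-! ### Isometry -/

theorem mu_eq : mu p q = ((volume : Measure (Eu (p + 1))).prod
    (volume : Measure (Eu q))).withDensity fun z => ENNReal.ofReal (weight q z.2) := rfl

/-- Integrability in `y` is obtained on the frequency side and carried over by Plancherel. -/
theorem integrable_weight_inner_profile_swap (hq : 1 ≤ q)
    (f h : 𝓢(Eu (p + 1), ComplexClifford (p + q))) :
    Integrable fun y : Eu q => (weight q y : ℂ) *
      ∫ x, inner ℂ (segalBargmann p q f (x, y)) (segalBargmann p q h (x, y)) := by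
  refine (integrable_weight_inner_profile hq (𝓕 f) (𝓕 h)).integral_prod_left.congr
    (ae_of_all _ fun y => ?_)
  simp only [segalBargmann_eq, integral_const_mul]
  rw [integral_inner_fourierInv_fourierInv (integrable_profile _ y) (memLp_profile _ 2 y)
    (integrable_profile _ y) (memLp_profile _ 2 y)]

theorem memLp_segalBargmann (hq : 1 ≤ q) (f : 𝓢(Eu (p + 1), ComplexClifford (p + q))) :
    MemLp (segalBargmann p q f) 2 (mu p q) := by
  rw [memLp_two_iff_integrable_sq_norm (aestronglyMeasurable_segalBargmann f _), mu_eq,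
    integrable_withDensity_iff (by have := measurable_weight (q := q); fun_prop)
      (ae_of_all _ fun z => ENNReal.ofReal_lt_top)]
  simp only [ENNReal.toReal_ofReal (weight_nonneg hq _)]
  -- Slices in `x` are square integrable by Plancherel; their weighted squared norms are integrable
  -- in `y` by `integrable_weight_inner_profile_swap`.
  rw [integrable_prod_iff']
  · constructor
    · refine ae_of_all _ fun y => Integrable.mul_const (f := fun x => ‖segalBargmann p q f (x, y)‖ ^ 2)
        ?_ (weight q y)
      have := memLp_fourierInv (integrable_profile (𝓕 f) y) (memLp_profile (𝓕 f) 2 y)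
      simp only [segalBargmann_eq]
      exact (memLp_two_iff_integrable_sq_norm this.1).1 this
    · refine (integrable_weight_inner_profile_swap hq f f).re.congr (ae_of_all _ fun y => ?_)
      have h1 : ∀ x, inner ℂ (segalBargmann p q f (x, y)) (segalBargmann p q f (x, y)) =
          ((‖segalBargmann p q f (x, y)‖ ^ 2 : ℝ) : ℂ) := fun x => by
        rw [inner_self_eq_norm_sq_to_K]; simp
      have h2 : ∀ x, ‖‖segalBargmann p q f (x, y)‖ ^ 2 * weight q y‖ =
          ‖segalBargmann p q f (x, y)‖ ^ 2 * weight q y := fun x => by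
        have := weight_nonneg hq y
        exact Real.norm_of_nonneg (by positivity)
      simp only [h1, h2, integral_complex_ofReal, integral_mul_const]
      rw [← Complex.ofReal_mul, RCLike.re_to_complex, Complex.ofReal_re, mul_comm]
  · exact ((aestronglyMeasurable_segalBargmann f _).norm.pow 2).mul
      (measurable_weight.comp measurable_snd).aestronglyMeasurable

theorem l2Inner_segalBargmann (hq : 1 ≤ q) (f h : 𝓢(Eu (p + 1), ComplexClifford (p + q))) :
    l2Inner (mu p q) (segalBargmann p q f) (segalBargmann p q h) = l2Inner volume f h := by
  simp only [l2Inner, ← inner_eq_Sc]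
  have hint : Integrable (fun z => inner ℂ (segalBargmann p q f z) (segalBargmann p q h z))
      (mu p q) :=
    ((memLp_segalBargmann hq f).norm.integrable_mul (memLp_segalBargmann hq h).norm).mono'
      ((aestronglyMeasurable_segalBargmann f _).inner (aestronglyMeasurable_segalBargmann h _))
      (ae_of_all _ fun z => norm_inner_le_norm _ _)
  have hmw : Measurable fun z : Eu (p + 1) × Eu q => ENNReal.ofReal (weight q z.2) := by
    have := measurable_weight (q := q); fun_prop
  rw [mu_eq, integrable_withDensity_iff_integrable_smul' hmw
    (ae_of_all _ fun z => ENNReal.ofReal_lt_top)] at hint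
  rw [mu_eq, integral_withDensity_eq_integral_toReal_smul hmw
    (ae_of_all _ fun z => ENNReal.ofReal_lt_top), integral_prod_symm _ hint]
  simp only [ENNReal.toReal_ofReal (weight_nonneg hq _), Complex.real_smul, integral_const_mul]
  calc _ = ∫ y : Eu q, ∫ w : Eu (p + 1), (weight q y : ℂ) *
        inner ℂ (profile p q (𝓕 f : 𝓢(_, _)) y w) (profile p q (𝓕 h : 𝓢(_, _)) y w) := by
        congr 1
        funext y
        simp only [segalBargmann_eq, integral_const_mul]
        rw [integral_inner_fourierInv_fourierInv (integrable_profile _ y) (memLp_profile _ 2 y)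
          (integrable_profile _ y) (memLp_profile _ 2 y)]
    _ = ∫ w : Eu (p + 1), ∫ y : Eu q, (weight q y : ℂ) *
        inner ℂ (profile p q (𝓕 f : 𝓢(_, _)) y w) (profile p q (𝓕 h : 𝓢(_, _)) y w) :=
        integral_integral_swap (integrable_weight_inner_profile hq (𝓕 f) (𝓕 h))
    _ = ∫ w : Eu (p + 1), inner ℂ (𝓕 f w) (𝓕 h w) := by
        refine integral_congr_ae ?_
        -- Fubini gives integrability in `y` only for almost every `w`, which suffices.
        filter_upwards [(integrable_weight_inner_profile hq (𝓕 f) (𝓕 h)).prod_left_ae] with w hw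
        exact integral_weight_inner_profile hq _ _ w hw
    _ = _ := integral_inner_fourier_fourier f h

end SegalBargmann

theorem mainTheorem3 (p q : ℕ) (hq : 1 ≤ q)
    (f h : SchwartzMap (SegalBargmann.Eu (p + 1)) (SegalBargmann.ComplexClifford (p + q))) :
    MemLp (SegalBargmann.segalBargmann p q f) 2 (SegalBargmann.mu p q) ∧
    MemLp (SegalBargmann.segalBargmann p q h) 2 (SegalBargmann.mu p q) ∧
    SegalBargmann.l2Inner (SegalBargmann.mu p q)
        (SegalBargmann.segalBargmann p q f) (SegalBargmann.segalBargmann p q h) =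
      SegalBargmann.l2Inner (volume : Measure (SegalBargmann.Eu (p + 1))) f h :=
  ⟨SegalBargmann.memLp_segalBargmann hq f, SegalBargmann.memLp_segalBargmann hq h,
    SegalBargmann.l2Inner_segalBargmann hq f h⟩
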